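/- Let $\mathbb{F}$ be a division ring, $\sigma:\mathbb{F}\to\mathbb{F}$ a ring endomorphism and $\delta:\mathbb{F}\to\mathbb{F}$ a $\sigma$-derivation, that is, an additive map with $\delta(ab)=\sigma(a)\delta(b)+\delta(a)b$. Let $\mathbb{F}[x;\sigma,\delta]$ be the skew polynomial ring, whose elements are the finite sums $\sum_i F_i x^i$ with $F_i\in\mathbb{F}$, with multiplication determined by $xa=\sigma(a)x+\delta(a)$ for $a\in\mathbb{F}$. For $F,P\in\mathbb{F}[x;\sigma,\delta]$ with $P\neq 0$, let $F(P)$ be the remainder of $F$ under Euclidean division by $P$ on the right, i.e. the unique $R$ with $\deg R<\deg P$ and $F=GP+R$ for some $G$. An element $a\in\mathbb{F}$ is a zero of $F$ if $F(x-a)=0$. A finite set $\Psi\subseteq\mathbb{F}$ is called P-independent if some non-zero skew polynomial vanishes at all elements of $\Psi$ and the monic non-zero skew polynomial of least degree that vanishes at all elements of $\Psi$ has degree $|\Psi|$. For $\mathbf{a}=(a_1,\ldots,a_r)\in\mathbb{F}^r$, $r\geq 1$, put $P_{\mathbf{a}}=(x-a_r)\cdots(x-a_2)(x-a_1)$, and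 let the Hasse derivative $D_{\mathbf{a}}(F)\in\mathbb{F}$ be the (left) coefficient of $x^{r-1}$ in the remainder $F(P_{\mathbf{a}})$. Equivalently, it is the unique $d \in \mathbb{F}$ such that $F=GP_{\mathbf{a}}+d\,P_{(a_1,\ldots,a_{r-1})}+H$ for some $G$ and some $H$ with $\deg H<r-1$ (where the empty product is $1$). The sequence $\mathbf{a}$ is a $(\sigma,\delta)$-multiplicity sequence if $a_1$ is the only zero of $P_{\mathbf{a}}$ in $\mathbb{F}$. For sequences $\mathbf{a}_i=(a_{i,1},\ldots,a_{i,r_i})\in\mathbb{F}^{r_i}$, $i=1,\ldots,n$, write $\mathbf{a}_{i,j}=(a_{i,1},\ldots,a_{i,j})$. The confluent Vandermonde matrix $V_N(\mathbf{a}_1,\ldots,\mathbf{a}_n)$ is the $N\times\sum_i r_i$ matrix over $\mathbb{F}$ whose rows are indexed by $k=0,1,\ldots,N-1$, whose columns are indexed by the pairs $(i,j)$ with $1\leq i\leq n$, $1\leq j\leq r_i$ in lexicographic order, and whose $(k,(i,j))$ entry is $D_{\mathbf{a}_{i,j}}(x^k)$. **Theorem.** Let $\Psi=\{a_1,\ldots,a_n\}\subseteq\mathbb{F}$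 be a set of size $n\geq 1$ and let $r_1,\ldots,r_n\geq 1$ be integers. Assume that, for each $i$, there is at least one $(\sigma,\delta)$-multiplicity sequence of length $r_i$ starting at $a_i$. Then the following are equivalent: 1. $\Psi$ is P-independent. 2. For all $b_{i,j}\in\mathbb{F}$ and all $(\sigma,\delta)$-multiplicity sequences $\mathbf{a}_{i,j}=(a_{i,1},\ldots,a_{i,j})$ with $a_{i,1}=a_i$, for $j=1,\ldots,r_i$ and $i=1,\ldots,n$ (for each $i$, these are the initial segments of one sequence $(a_{i,1},\ldots,a_{i,r_i})$), there is a unique $F\in\mathbb{F}[x;\sigma,\delta]$ with $\deg F<\sum_{i=1}^n r_i$ such that $D_{\mathbf{a}_{i,j}}(F)=b_{i,j}$ for all $j=1,\ldots,r_i$ and $i=1,\ldots,n$. 3. For all $(\sigma,\delta)$-multiplicity sequences $\mathbf{a}_i=(a_{i,1},\ldots,a_{i,r_i})\in\mathbb{F}^{r_i}$ with $a_{i,1}=a_i$, $i=1,\ldots,n$, and with $N=\sum_{i=1}^n r_i$, the $N\times N$ matrix $V_N(\mathbf{a}_1,\ldots,\mathbf{a}_n)$ is invertible. -/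

import Mathlib

namespace Ore

/-- A `σ`-derivation of a division ring: an additive map `δ` with
`δ (a * b) = σ a * δ b + δ a * b`. -/
structure SkewDerivation {F : Type*} [DivisionRing F] (σ : F →+* F) extends F →+ F where
  leibniz' : ∀ a b : F, toFun (a * b) = σ a * toFun b + toFun a * b

variable {F : Type*} [DivisionRing F] {σ : F →+* F} {δ : SkewDerivation σ}

/-- The skew polynomial ring `F[x; σ, δ]`: as a left vector space over `F`, it has the basis
`1, x, x ^ 2, …`, so that an element is its finitely supported family of (left) coefficients. -/
def SkewPoly (σ : F →+* F) (_δ : SkewDerivation σ) : Type _ := ℕ →₀ F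

namespace SkewPoly

noncomputable instance : AddCommGroup (SkewPoly σ δ) := inferInstanceAs (AddCommGroup (ℕ →₀ F))

noncomputable instance : Module F (SkewPoly σ δ) := inferInstanceAs (Module F (ℕ →₀ F))

/-- The coefficient of `x ^ n`, where coefficients are written on the left. -/
def coeff (f : SkewPoly σ δ) (n : ℕ) : F := Finsupp.toFun f n

/-- The set of exponents with a non-zero coefficient. -/
def support (f : SkewPoly σ δ) : Finset ℕ := Finsupp.support f

/-- The skew polynomial `a x ^ n`, additively in `a`. -/
noncomputable def monomial (n : ℕ) : F →+ SkewPoly σ δ := Finsupp.singleAddHom n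

theorem mem_support {f : SkewPoly σ δ} {n : ℕ} : n ∈ f.support ↔ f.coeff n ≠ 0 :=
  Finsupp.mem_support_iff

@[ext] theorem ext {f g : SkewPoly σ δ} (h : ∀ n, f.coeff n = g.coeff n) : f = g :=
  Finsupp.ext h

@[simp] theorem coeff_zero (n : ℕ) : (0 : SkewPoly σ δ).coeff n = 0 := rfl
@[simp] theorem coeff_add (f g : SkewPoly σ δ) (n : ℕ) :
    (f + g).coeff n = f.coeff n + g.coeff n := rfl
@[simp] theorem coeff_neg (f : SkewPoly σ δ) (n : ℕ) : (-f).coeff n = -f.coeff n := rfl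
@[simp] theorem coeff_sub (f g : SkewPoly σ δ) (n : ℕ) :
    (f - g).coeff n = f.coeff n - g.coeff n := rfl
@[simp] theorem coeff_smul (c : F) (f : SkewPoly σ δ) (n : ℕ) :
    (c • f).coeff n = c * f.coeff n := rfl
theorem coeff_monomial (m n : ℕ) (a : F) :
    (monomial m a : SkewPoly σ δ).coeff n = if m = n then a else 0 :=
  Finsupp.single_apply

theorem smul_monomial (c a : F) (n : ℕ) :
    c • (monomial n a : SkewPoly σ δ) = monomial n (c * a) :=
  Finsupp.smul_single c n a

theorem addHom_ext {M : Type*} [AddCommGroup M] {φ ψ : SkewPoly σ δ →+ M}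
    (h : ∀ n a, φ (monomial n a) = ψ (monomial n a)) : φ = ψ :=
  Finsupp.addHom_ext h

/-- Left multiplication by `x`, determined by `x (a x ^ n) = σ a x ^ (n + 1) + δ a x ^ n`. -/
noncomputable def mulX : SkewPoly σ δ →+ SkewPoly σ δ :=
  Finsupp.liftAddHom fun n =>
    (monomial (n + 1)).comp σ.toAddMonoidHom + (monomial n).comp δ.toAddMonoidHom

theorem mulX_monomial (n : ℕ) (a : F) :
    mulX (monomial n a : SkewPoly σ δ)
      = monomial (n + 1) (σ a) + monomial n (δ.toAddMonoidHom a) := by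
  refine (Finsupp.liftAddHom_apply_single _ n a).trans ?_
  rfl

/-- Left multiplication by `x ^ n`. -/
noncomputable def mulXPow : ℕ → (SkewPoly σ δ →+ SkewPoly σ δ)
  | 0 => AddMonoidHom.id _
  | n + 1 => mulX.comp (mulXPow n)

/-- Left multiplication by `f = ∑ f_n x ^ n`, as the additive map `g ↦ ∑ f_n • (x ^ n g)`. -/
noncomputable def mulLeft : SkewPoly σ δ →+ (SkewPoly σ δ →+ SkewPoly σ δ) :=
  Finsupp.liftAddHom fun n => (smulAddHom F (SkewPoly σ δ →+ SkewPoly σ δ)).flip (mulXPow n)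

theorem mulLeft_monomial (n : ℕ) (a : F) (g : SkewPoly σ δ) :
    mulLeft (monomial n a) g = a • mulXPow n g :=
  DFunLike.congr_fun (Finsupp.liftAddHom_apply_single _ n a) g

noncomputable instance : Mul (SkewPoly σ δ) := ⟨fun f g => mulLeft f g⟩

noncomputable instance : One (SkewPoly σ δ) := ⟨monomial 0 1⟩

theorem mul_def (f g : SkewPoly σ δ) : f * g = mulLeft f g := rfl

theorem one_def : (1 : SkewPoly σ δ) = monomial 0 1 := rfl

theorem monomial_induction {p : SkewPoly σ δ → Prop} (f : SkewPoly σ δ) (h0 : p 0)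
    (hadd : ∀ f g, p f → p g → p (f + g)) (hm : ∀ n a, p (monomial n a)) : p f :=
  Finsupp.induction_linear f h0 hadd hm

theorem derivation_one : δ.toAddMonoidHom 1 = 0 := by
  have h : δ.toAddMonoidHom (1 * 1) = σ 1 * δ.toAddMonoidHom 1 + δ.toAddMonoidHom 1 * 1 :=
    δ.leibniz' 1 1
  simpa using h

theorem mulX_smul (c : F) (f : SkewPoly σ δ) :
    mulX (c • f) = σ c • mulX f + δ.toAddMonoidHom c • f := by
  induction f using monomial_induction with
  | h0 => simp
  | hadd f g hf hg => simp only [smul_add, map_add, hf, hg]; abel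
  | hm n a =>
    have hl : δ.toAddMonoidHom (c * a)
        = σ c * δ.toAddMonoidHom a + δ.toAddMonoidHom c * a := δ.leibniz' c a
    simp only [smul_monomial, mulX_monomial, smul_add, map_mul, hl, map_add]
    abel

theorem mulLeft_smul (c : F) (f g : SkewPoly σ δ) : mulLeft (c • f) g = c • mulLeft f g := by
  induction f using monomial_induction with
  | h0 => simp
  | hadd f f' hf hf' => simp only [smul_add, map_add, AddMonoidHom.add_apply, hf, hf']
  | hm n a => rw [smul_monomial, mulLeft_monomial, mulLeft_monomial, mul_smul]

theorem mulLeft_mulX (f g : SkewPoly σ δ) : mulLeft (mulX f) g = mulX (mulLeft f g) := by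
  induction f using monomial_induction with
  | h0 => simp
  | hadd f f' hf hf' => simp only [map_add, AddMonoidHom.add_apply, hf, hf']
  | hm n a =>
    rw [mulX_monomial, map_add, AddMonoidHom.add_apply, mulLeft_monomial, mulLeft_monomial,
      mulLeft_monomial, mulX_smul]
    rfl

theorem mulLeft_mulLeft (f g h : SkewPoly σ δ) :
    mulLeft (mulLeft f g) h = mulLeft f (mulLeft g h) := by
  have hX : ∀ n : ℕ, mulLeft (mulXPow n g) h = mulXPow n (mulLeft g h) := by
    intro n
    induction n with
    | zero => rfl
    | succ n ih => exact (mulLeft_mulX _ _).trans (congrArg mulX ih)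
  induction f using monomial_induction with
  | h0 => simp
  | hadd f f' hf hf' => simp only [map_add, AddMonoidHom.add_apply, hf, hf']
  | hm n a => rw [mulLeft_monomial, mulLeft_monomial, mulLeft_smul, hX]

theorem mulXPow_one (n : ℕ) : mulXPow n (monomial 0 1 : SkewPoly σ δ) = monomial n 1 := by
  induction n with
  | zero => rfl
  | succ n ih =>
    refine (congrArg mulX ih).trans ?_
    rw [mulX_monomial, derivation_one]
    simp

noncomputable instance instRing : Ring (SkewPoly σ δ) :=
  { (inferInstance : AddCommGroup (SkewPoly σ δ)) with
    mul := (· * ·)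
    one := 1
    left_distrib := fun f g h => map_add (mulLeft f) g h
    right_distrib := fun f g h => by
      simp only [mul_def, map_add, AddMonoidHom.add_apply]
    zero_mul := fun f => by
      simp only [mul_def, map_zero, AddMonoidHom.zero_apply]
    mul_zero := fun f => map_zero (mulLeft f)
    mul_assoc := mulLeft_mulLeft
    one_mul := fun f => by
      rw [mul_def, one_def, mulLeft_monomial, one_smul]
      rfl
    mul_one := fun f => by
      rw [mul_def, one_def]
      induction f using monomial_induction with
      | h0 => simp
      | hadd f g hf hg => simp only [map_add, AddMonoidHom.add_apply, hf, hg]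
      | hm n a => rw [mulLeft_monomial, mulXPow_one, smul_monomial, mul_one] }

/-- The inclusion of the division ring `F` as the constants. -/
noncomputable def C (a : F) : SkewPoly σ δ := monomial 0 a

/-- The variable `x`. -/
noncomputable def X : SkewPoly σ δ := monomial 1 1

theorem C_mul (a : F) (f : SkewPoly σ δ) : C a * f = a • f :=
  mulLeft_monomial 0 a f

theorem X_mul (f : SkewPoly σ δ) : X * f = mulX f :=
  (mulLeft_monomial 1 1 f).trans (one_smul _ _)

/-- The defining commutation rule `x a = σ(a) x + δ(a)`. -/
theorem X_mul_C (a : F) :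
    (X : SkewPoly σ δ) * C a = C (σ a) * X + C (δ.toAddMonoidHom a) := by
  rw [X_mul, C, mulX_monomial, C_mul, X, smul_monomial, mul_one, C]

theorem X_pow (n : ℕ) : (X ^ n : SkewPoly σ δ) = monomial n 1 := by
  induction n with
  | zero => rfl
  | succ n ih =>
    rw [pow_succ', ih, X_mul, mulX_monomial, derivation_one]
    simp

theorem C_mul_X_pow (a : F) (n : ℕ) : (C a * X ^ n : SkewPoly σ δ) = monomial n a := by
  rw [C_mul, X_pow, smul_monomial, mul_one]

/-! ### Degree and division with remainder -/

/-- The degree, with `deg 0 = -∞`. -/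
def degree (f : SkewPoly σ δ) : WithBot ℕ := f.support.max

/-- `f` is monic: its coefficient at its degree is `1`. -/
def Monic (f : SkewPoly σ δ) : Prop := ∃ n : ℕ, f.degree = n ∧ f.coeff n = 1

theorem degree_lt_iff {f : SkewPoly σ δ} {n : ℕ} :
    f.degree < n ↔ ∀ m, n ≤ m → f.coeff m = 0 := by
  refine (Finset.sup_lt_iff (WithBot.bot_lt_coe n)).trans ?_
  constructor
  · intro h m hm
    by_contra hc
    exact absurd (WithBot.coe_lt_coe.1 (h m (mem_support.2 hc))) (not_lt.2 hm)
  · intro h m hm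
    refine WithBot.coe_lt_coe.2 (lt_of_not_ge fun hc => mem_support.1 hm (h m hc))

theorem degree_eq_iff {f : SkewPoly σ δ} {n : ℕ} :
    f.degree = n ↔ f.coeff n ≠ 0 ∧ ∀ m, n < m → f.coeff m = 0 := by
  constructor
  · intro h
    refine ⟨mem_support.1 (Finset.mem_of_max h), fun m hm => ?_⟩
    exact degree_lt_iff.1 (h.trans_lt (WithBot.coe_lt_coe.2 (Nat.lt_succ_self n))) m hm
  · rintro ⟨h1, h2⟩
    refine le_antisymm ?_ (Finset.le_max (mem_support.2 h1))
    refine Finset.max_le fun m hm => WithBot.coe_le_coe.2 (le_of_not_gt fun hc => ?_)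
    exact mem_support.1 hm (h2 m hc)

theorem exists_degree {f : SkewPoly σ δ} (hf : f ≠ 0) : ∃ n : ℕ, f.degree = n := by
  refine Finset.max_of_nonempty ?_
  rw [Finset.nonempty_iff_ne_empty]
  intro h
  refine hf (ext fun n => ?_)
  by_contra hc
  have := mem_support.2 hc
  rw [h] at this
  simp at this

theorem coeff_mulX_succ (f : SkewPoly σ δ) (n : ℕ) :
    (mulX f).coeff (n + 1) = σ (f.coeff n) + δ.toAddMonoidHom (f.coeff (n + 1)) := by
  induction f using monomial_induction with
  | h0 => simp
  | hadd f g hf hg => simp only [map_add, coeff_add, hf, hg]; abel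
  | hm m a =>
    simp only [mulX_monomial, coeff_add, coeff_monomial, add_left_inj, apply_ite σ,
      apply_ite δ.toAddMonoidHom, map_zero]

theorem degree_mulXPow {f : SkewPoly σ δ} {n : ℕ} (h : f.degree = n) (k : ℕ) :
    (mulXPow k f).degree = (k + n : ℕ) := by
  induction k with
  | zero => rw [Nat.zero_add]; exact h
  | succ k ih =>
    obtain ⟨h1, h2⟩ := degree_eq_iff.1 ih
    rw [Nat.succ_add]
    refine degree_eq_iff.2 ⟨?_, ?_⟩
    · change (mulX (mulXPow k f)).coeff (k + n + 1) ≠ 0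
      rw [coeff_mulX_succ, h2 _ (Nat.lt_succ_self _), map_zero, add_zero]
      exact (map_ne_zero σ).2 h1
    · intro m hm
      obtain ⟨m, rfl⟩ : ∃ m', m = m' + 1 := ⟨m - 1, by omega⟩
      change (mulX (mulXPow k f)).coeff (m + 1) = 0
      rw [coeff_mulX_succ, h2 _ (by omega), h2 _ (by omega), map_zero, map_zero, add_zero]

theorem monomial_mul (k : ℕ) (c : F) (f : SkewPoly σ δ) :
    monomial k c * f = c • mulXPow k f := mulLeft_monomial k c f

theorem degree_mul_of_degree_eq {f g : SkewPoly σ δ} {m n : ℕ} (hf : f.degree = m)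
    (hg : g.degree = n) : (f * g).degree = (m + n : ℕ) := by
  induction m using Nat.strong_induction_on generalizing f with
  | _ m ih =>
    obtain ⟨h1, h2⟩ := degree_eq_iff.1 hf
    have hsplit : f = monomial m (f.coeff m) + (f - monomial m (f.coeff m)) := by abel
    have hlow : ∀ k, m ≤ k → (f - monomial m (f.coeff m)).coeff k = 0 := by
      intro k hk
      rw [coeff_sub, coeff_monomial]
      rcases hk.eq_or_lt with rfl | hk
      · simp
      · rw [h2 k hk, if_neg hk.ne, sub_zero]
    have hrest : ∀ k, m + n ≤ k → ((f - monomial m (f.coeff m)) * g).coeff k = 0 := by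
      rcases eq_or_ne (f - monomial m (f.coeff m)) 0 with h0 | h0
      · intro k _
        rw [h0, zero_mul, coeff_zero]
      · obtain ⟨m', hm'⟩ := exists_degree h0
        have hlt : m' < m := by
          by_contra hc
          exact (degree_eq_iff.1 hm').1 (hlow m' (not_lt.1 hc))
        intro k hk
        exact (degree_eq_iff.1 (ih m' hlt hm')).2 k (by omega)
    obtain ⟨g1, g2⟩ := degree_eq_iff.1 (degree_mulXPow hg m)
    rw [hsplit, add_mul, monomial_mul]
    refine degree_eq_iff.2 ⟨?_, ?_⟩
    · rw [coeff_add, hrest _ le_rfl, add_zero, coeff_smul]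
      exact mul_ne_zero h1 g1
    · intro k hk
      rw [coeff_add, hrest _ hk.le, add_zero, coeff_smul, g2 k hk, mul_zero]

/-- Right Euclidean division. -/
theorem existsUnique_remainder (f : SkewPoly σ δ) {p : SkewPoly σ δ} (hp : p ≠ 0) :
    ∃! r : SkewPoly σ δ, r.degree < p.degree ∧ ∃ q, f = q * p + r := by
  obtain ⟨n, hn⟩ := exists_degree hp
  rw [hn]
  refine existsUnique_of_exists_of_unique ?_ ?_
  · suffices H : ∀ (m : ℕ) (f : SkewPoly σ δ), f.degree < m →
        ∃ r : SkewPoly σ δ, r.degree < n ∧ ∃ q, f = q * p + r by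
      rcases eq_or_ne f 0 with rfl | hf
      · exact H 0 0 (degree_lt_iff.2 fun _ _ => rfl)
      · obtain ⟨m, hm⟩ := exists_degree hf
        exact H (m + 1) f (hm.trans_lt (WithBot.coe_lt_coe.2 (Nat.lt_succ_self m)))
    intro m
    induction m with
    | zero =>
      intro f hf
      exact ⟨f, hf.trans_le (WithBot.coe_le_coe.2 (Nat.zero_le n)), 0, by rw [zero_mul, zero_add]⟩
    | succ m ih =>
      intro f hf
      rcases lt_or_ge m n with hmn | hmn
      · exact ⟨f, hf.trans_le (WithBot.coe_le_coe.2 hmn), 0, by rw [zero_mul, zero_add]⟩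
      · obtain ⟨g1, g2⟩ := degree_eq_iff.1 (degree_mulXPow hn (m - n))
        rw [Nat.sub_add_cancel hmn] at g1 g2
        set c := f.coeff m * ((mulXPow (m - n) p).coeff m)⁻¹ with hc
        obtain ⟨r, hr, q, hq⟩ := ih (f - monomial (m - n) c * p) (degree_lt_iff.2 fun k hk => by
          rw [monomial_mul, coeff_sub, coeff_smul]
          rcases hk.eq_or_lt with rfl | hk
          · rw [hc, inv_mul_cancel_right₀ g1, sub_self]
          · rw [g2 k hk, mul_zero, sub_zero, degree_lt_iff.1 hf k hk])
        refine ⟨r, hr, q + monomial (m - n) c, ?_⟩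
        rw [add_mul, add_right_comm, ← hq]
        abel
  · rintro r r' ⟨hr, q, hq⟩ ⟨hr', q', hq'⟩
    have h : (q - q') * p = r' - r := by
      rw [sub_mul, sub_eq_sub_iff_add_eq_add, ← hq, hq', add_comm]
    rcases eq_or_ne (q - q') 0 with h0 | h0
    · rw [h0, zero_mul] at h
      exact (sub_eq_zero.1 h.symm).symm
    · obtain ⟨m, hm⟩ := exists_degree h0
      refine absurd ?_ (degree_eq_iff.1 (degree_mul_of_degree_eq hm hn)).1
      rw [h, coeff_sub, degree_lt_iff.1 hr _ (by omega), degree_lt_iff.1 hr' _ (by omega), sub_zero]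

open Classical in
/-- The value `f(p)`: the remainder of `f` under Euclidean division by `p` on the right
(only used for `p ≠ 0`). -/
noncomputable def evalAt (f p : SkewPoly σ δ) : SkewPoly σ δ :=
  if hp : p ≠ 0 then (existsUnique_remainder f hp).choose else f

theorem evalAt_spec (f : SkewPoly σ δ) {p : SkewPoly σ δ} (hp : p ≠ 0) :
    (f.evalAt p).degree < p.degree ∧ ∃ q, f = q * p + f.evalAt p := by
  rw [evalAt, dif_pos hp]
  exact (existsUnique_remainder f hp).choose_spec.1

/-! ### Minimal skew polynomials and P-independence -/

/-- `I(Ω)`: the skew polynomials vanishing at all points of `Ω`. -/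
def vanishing (Ω : Set (SkewPoly σ δ)) : Set (SkewPoly σ δ) := {f | ∀ p ∈ Ω, f.evalAt p = 0}

/-- `Ω` is algebraic: `I(Ω) ≠ {0}`. -/
def IsAlgebraicSet (Ω : Set (SkewPoly σ δ)) : Prop := vanishing Ω ≠ {0}

/-- `m` is a monic (hence non-zero) element of `I(Ω)` whose degree is minimal among the
non-zero elements of `I(Ω)`. -/
def IsMinimalFor (Ω : Set (SkewPoly σ δ)) (m : SkewPoly σ δ) : Prop :=
  m ∈ vanishing Ω ∧ m.Monic ∧ ∀ f ∈ vanishing Ω, f ≠ 0 → m.degree ≤ f.degree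

theorem evalAt_eq_zero_iff {f p : SkewPoly σ δ} : f.evalAt p = 0 ↔ ∃ q, f = q * p := by
  by_cases hp : p = 0
  · subst hp
    simp [evalAt]
  · constructor
    · intro h
      obtain ⟨q, hq⟩ := (evalAt_spec f hp).2
      exact ⟨q, by rw [hq, h, add_zero]⟩
    · rintro ⟨q, hq⟩
      refine (existsUnique_remainder f hp).unique (evalAt_spec f hp) ⟨?_, q, by rw [hq, add_zero]⟩
      obtain ⟨n, hn⟩ := exists_degree hp
      rw [hn]
      exact WithBot.bot_lt_coe n

theorem existsUnique_isMinimalFor {Ω : Set (SkewPoly σ δ)} (h : IsAlgebraicSet Ω) :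
    ∃! m, IsMinimalFor Ω m := by
  have hsub : ∀ f ∈ vanishing Ω, ∀ g ∈ vanishing Ω, f - g ∈ vanishing Ω := by
    intro f hf g hg p hp
    obtain ⟨q, rfl⟩ := evalAt_eq_zero_iff.1 (hf p hp)
    obtain ⟨q', rfl⟩ := evalAt_eq_zero_iff.1 (hg p hp)
    exact evalAt_eq_zero_iff.2 ⟨q - q', (sub_mul _ _ _).symm⟩
  have hsmul : ∀ (c : F), ∀ f ∈ vanishing Ω, c • f ∈ vanishing Ω := by
    intro c f hf p hp
    obtain ⟨q, rfl⟩ := evalAt_eq_zero_iff.1 (hf p hp)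
    exact evalAt_eq_zero_iff.2 ⟨C c * q, by rw [mul_assoc, C_mul]⟩
  have h0 : (0 : SkewPoly σ δ) ∈ vanishing Ω :=
    fun p _ => evalAt_eq_zero_iff.2 ⟨0, (zero_mul p).symm⟩
  refine existsUnique_of_exists_of_unique ?_ ?_
  · have hne : ∃ n : ℕ, ∃ f ∈ vanishing Ω, f.degree = n := by
      by_contra hcon
      refine h (Set.Subset.antisymm (fun f hf => ?_) (Set.singleton_subset_iff.2 h0))
      by_contra hf0
      obtain ⟨n, hn⟩ := exists_degree hf0
      exact hcon ⟨n, f, hf, hn⟩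
    classical
    obtain ⟨f, hf, hd⟩ := Nat.find_spec hne
    obtain ⟨h1, h2⟩ := degree_eq_iff.1 hd
    have hd' : ((f.coeff (Nat.find hne))⁻¹ • f).degree = (Nat.find hne : ℕ) := by
      refine degree_eq_iff.2 ⟨?_, fun k hk => ?_⟩
      · rw [coeff_smul, inv_mul_cancel₀ h1]
        exact one_ne_zero
      · rw [coeff_smul, h2 k hk, mul_zero]
    refine ⟨_, hsmul (f.coeff (Nat.find hne))⁻¹ f hf,
      ⟨_, hd', by rw [coeff_smul, inv_mul_cancel₀ h1]⟩, fun g hg hg0 => ?_⟩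
    obtain ⟨k, hk⟩ := exists_degree hg0
    rw [hd', hk]
    exact WithBot.coe_le_coe.2 (Nat.find_min' hne ⟨g, hg, hk⟩)
  · rintro m m' ⟨hm, ⟨k, hk, hk1⟩, hmin⟩ ⟨hm', ⟨k', hk', hk1'⟩, hmin'⟩
    have hn0 : ∀ {g : SkewPoly σ δ} {i : ℕ}, g.coeff i = 1 → g ≠ 0 := by
      rintro g i hi rfl
      exact one_ne_zero hi.symm
    have hkk : k = k' := by
      have h1 := hmin m' hm' (hn0 hk1')
      have h2 := hmin' m hm (hn0 hk1)
      rw [hk, hk'] at h1 h2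
      exact le_antisymm (WithBot.coe_le_coe.1 h1) (WithBot.coe_le_coe.1 h2)
    subst hkk
    by_contra hne
    have hlt : (m - m').degree < k := by
      refine degree_lt_iff.2 fun i hi => ?_
      rw [coeff_sub]
      rcases hi.eq_or_lt with rfl | hi
      · rw [hk1, hk1', sub_self]
      · rw [(degree_eq_iff.1 hk).2 i hi, (degree_eq_iff.1 hk').2 i hi, sub_zero]
    have := hmin _ (hsub m hm m' hm') (sub_ne_zero.2 hne)
    rw [hk] at this
    exact absurd hlt (not_lt.2 this)

open Classical in
/-- The minimal skew polynomial `F_Ω`, which is `0` if `Ω` is not algebraic. -/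
noncomputable def minSkewPoly (Ω : Set (SkewPoly σ δ)) : SkewPoly σ δ :=
  if h : IsAlgebraicSet Ω then (existsUnique_isMinimalFor h).choose else 0

/-- A set `Ω` of skew polynomials of degree at least `1` is P-independent if it is finite and
algebraic and the degree of `F_Ω` is the sum of the degrees of the elements of `Ω`. -/
def PIndependent (Ω : Set (SkewPoly σ δ)) : Prop :=
  Ω.Finite ∧ IsAlgebraicSet Ω ∧ (minSkewPoly Ω).degree = ∑ᶠ p ∈ Ω, p.degree

/-- A set `Ψ ⊆ F` is P-independent if `{x - a | a ∈ Ψ}` is. -/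
def PIndependentPoints (σ : F →+* F) (δ : SkewDerivation σ) (Ψ : Set F) : Prop :=
  PIndependent ((fun a => (X - C a : SkewPoly σ δ)) '' Ψ)

/-! ### Multiplicity sequences, Hasse derivatives and confluent Vandermonde matrices -/

/-- `P_𝐚 = (x - a_r) ⋯ (x - a_2) (x - a_1)` for `𝐚 = (a_1, …, a_r)`. -/
noncomputable def linProd (σ : F →+* F) (δ : SkewDerivation σ) {r : ℕ} (a : Fin r → F) :
    SkewPoly σ δ :=
  ((List.ofFn a).reverse.map fun c => X - C c).prod

/-- `(a_1, …, a_r)`, with `r ≥ 1`, is a `(σ, δ)`-multiplicity sequence: `a_1` is the only zero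
of `P_𝐚` in `F`. -/
def IsMultiplicitySeq (σ : F →+* F) (δ : SkewDerivation σ) {r : ℕ} (a : Fin r → F) : Prop :=
  ∃ hr : 0 < r, {b : F | (linProd σ δ a).evalAt (X - C b) = 0} = {a ⟨0, hr⟩}

/-- The Hasse derivative `D_𝐚(f)` at `𝐚 = (a_1, …, a_{j+1})`: the coefficient of `x ^ j` in the
remainder of `f` under division by `P_𝐚` on the right. As `P_{(a_1, …, a_j)}` is monic of degree
`j`, it is the unique `d ∈ F` such that `f = g P_𝐚 + d P_{(a_1, …, a_j)} + h` for some `g` and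
some `h` of degree less than `j`. -/
noncomputable def hasseDeriv {j : ℕ} (a : Fin (j + 1) → F) (f : SkewPoly σ δ) : F :=
  (f.evalAt (linProd σ δ a)).coeff j

/-- The initial segment `(a_1, …, a_{j+1})` of `(a_1, …, a_r)`, for `j < r`. -/
def initSeg {r : ℕ} (a : Fin r → F) (j : Fin r) : Fin (j + 1) → F :=
  fun k => a (Fin.castLE j.isLt k)

/-- The confluent Vandermonde matrix `V_N(𝐚_1, …, 𝐚_n)` with `N` rows and `r_1 + ⋯ + r_n`
columns, the columns being ordered lexicographically: the entry in row `k` (counted from `0`)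
and in the `j`-th column of the `i`-th block is `D_{𝐚_{i,j}}(x ^ k)`. -/
noncomputable def confluentVandermonde (σ : F →+* F) (δ : SkewDerivation σ) {n : ℕ}
    {r : Fin n → ℕ} (N : ℕ) (s : ∀ i, Fin (r i) → F) : Matrix (Fin N) (Fin (∑ i, r i)) F :=
  Matrix.of fun k c =>
    let ij := finSigmaFinEquiv.symm c
    hasseDeriv (initSeg (s ij.1) ij.2) (X ^ (k : ℕ) : SkewPoly σ δ)

end SkewPoly
end Ore

/-! Fix sequences `s i` with total length `N`. Taking all Hasse derivatives along their initial
segments is a left-linear map `hasseMap` from skew polynomials to `F^N`, and its kernel is the left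
ideal of common left multiples of the `linProd σ δ (s i)`. A dimension count gives a non-zero kernel
element of degree at most `N`; dividing by it shows that `hasseMap` is surjective iff its
restriction to degree below `N` is surjective, hence iff that restriction is injective. Statements 2
and 3 both express this surjectivity for multiplicity sequences, and P-independence is the same
condition for the sequences of length one.

It remains to pass between points and sequences. Restricting to first entries is immediate. The
converse, `exists_forall_eq_mul_linProd_add`, is a noncommutative Chinese remainder argument. If the
map from the ring to the product of the cyclic modules modulo `linProd σ δ (s i)` were not onto, its
image would lie in a maximal submodule `K`. In the simple quotient by `K`, an element killed by
`linProd σ δ (s i)` is already killed by `x - a_i`, because `a_i` is the only zero of that product.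
Only the points `a_i` matter there, and a skew polynomial taking the values of `1` at `a_i` and `0`
at the other points puts the `i`-th generator into `K`, which is absurd. -/

namespace Ore
namespace SkewPoly
variable {F : Type*} [DivisionRing F] {σ : F →+* F} {δ : SkewDerivation σ}

/-! ### Skew polynomials of bounded degree as a finite-dimensional space -/

/-- The skew polynomial `∑ v_k x ^ k` of degree less than `N`. -/
noncomputable def ofCoeffs (σ : F →+* F) (δ : SkewDerivation σ) (N : ℕ) :
    (Fin N → F) →ₗ[F] SkewPoly σ δ where
  toFun v := ∑ k : Fin N, monomial (k : ℕ) (v k)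
  map_add' v w := by simp [Finset.sum_add_distrib]
  map_smul' c v := by simp [Finset.smul_sum, smul_monomial]

theorem ofCoeffs_apply {N : ℕ} (v : Fin N → F) :
    ofCoeffs σ δ N v = ∑ k : Fin N, monomial (k : ℕ) (v k) := rfl

theorem coeff_sum {ι : Type*} (s : Finset ι) (f : ι → SkewPoly σ δ) (n : ℕ) :
    (∑ i ∈ s, f i).coeff n = ∑ i ∈ s, (f i).coeff n := by
  classical
  induction s using Finset.induction_on with
  | empty => rfl
  | insert i s hi ih => rw [Finset.sum_insert hi, Finset.sum_insert hi, coeff_add, ih]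

theorem coeff_ofCoeffs {N : ℕ} (v : Fin N → F) (k : Fin N) :
    (ofCoeffs σ δ N v).coeff k = v k := by
  simp [ofCoeffs_apply, coeff_sum, coeff_monomial, Fin.val_inj]

theorem coeff_ofCoeffs_of_le {N : ℕ} (v : Fin N → F) {k : ℕ} (hk : N ≤ k) :
    (ofCoeffs σ δ N v).coeff k = 0 := by
  rw [ofCoeffs_apply, coeff_sum]
  refine Finset.sum_eq_zero fun i _ => ?_
  rw [coeff_monomial, if_neg (by omega)]

theorem degree_ofCoeffs_lt {N : ℕ} (v : Fin N → F) : (ofCoeffs σ δ N v).degree < N :=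
  degree_lt_iff.2 fun _ hk => coeff_ofCoeffs_of_le v hk

theorem ofCoeffs_injective (N : ℕ) : Function.Injective (ofCoeffs σ δ N) := fun v w h =>
  funext fun k => by rw [← coeff_ofCoeffs (σ := σ) (δ := δ) v k, h, coeff_ofCoeffs]

theorem exists_ofCoeffs_eq {N : ℕ} {f : SkewPoly σ δ} (hf : f.degree < N) :
    ∃ v, ofCoeffs σ δ N v = f := by
  refine ⟨fun k => f.coeff k, ext fun k => ?_⟩
  rcases lt_or_ge k N with hk | hk
  · exact coeff_ofCoeffs _ (⟨k, hk⟩ : Fin N)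
  · rw [coeff_ofCoeffs_of_le _ hk, degree_lt_iff.1 hf k hk]

/-! ### Finitely many linear conditions and dimension counting -/

section LinearConditions

variable {ι : Type*} [Fintype ι] (E : SkewPoly σ δ →ₗ[F] (ι → F))

theorem injective_comp_ofCoeffs_iff {N : ℕ} (hN : N = Fintype.card ι) :
    Function.Injective (E ∘ₗ ofCoeffs σ δ N) ↔ Function.Surjective (E ∘ₗ ofCoeffs σ δ N) :=
  LinearMap.injective_iff_surjective_of_finrank_eq_finrank (by simp [hN])

theorem exists_ne_zero_degree_le :
    ∃ f : SkewPoly σ δ, f ≠ 0 ∧ f.degree ≤ Fintype.card ι ∧ E f = 0 := by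
  -- One more coefficient than there are conditions.
  have h : LinearMap.ker (E ∘ₗ ofCoeffs σ δ (Fintype.card ι + 1)) ≠ ⊥ :=
    LinearMap.ker_ne_bot_of_finrank_lt (by simp)
  obtain ⟨v, hv, hv0⟩ := (Submodule.ne_bot_iff _).1 h
  have hne : ofCoeffs σ δ _ v ≠ 0 := fun h0 =>
    hv0 (ofCoeffs_injective _ (h0.trans (map_zero _).symm))
  refine ⟨_, hne, ?_, hv⟩
  obtain ⟨m, hm⟩ := exists_degree hne
  have := degree_ofCoeffs_lt (σ := σ) (δ := δ) v
  rw [hm] at this ⊢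
  exact WithBot.coe_le_coe.2 (Nat.lt_succ_iff.1 (WithBot.coe_lt_coe.1 this))

/-- Since the kernel is a left ideal, replacing `f` by its remainder modulo a kernel element `p`
with `deg p ≤ N` does not change `E f`, and that remainder has degree below `N`. -/
theorem surjective_comp_ofCoeffs_iff (hE : ∀ g f, E f = 0 → E (g * f) = 0) {N : ℕ}
    (hN : N = Fintype.card ι) :
    Function.Surjective (E ∘ₗ ofCoeffs σ δ N) ↔ Function.Surjective E := by
  refine ⟨fun h b => (h b).imp' (ofCoeffs σ δ N) fun _ h => h, fun h b => ?_⟩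
  obtain ⟨f, rfl⟩ := h b
  obtain ⟨p, hp, hd, hp0⟩ := exists_ne_zero_degree_le E
  obtain ⟨hr, q, hq⟩ := evalAt_spec f hp
  obtain ⟨v, hv⟩ := exists_ofCoeffs_eq (hr.trans_le (hN ▸ hd))
  refine ⟨v, ?_⟩
  rw [LinearMap.comp_apply, hv, hq, map_add, hE q p hp0, zero_add, ← hq]

end LinearConditions

/-! ### Remainders and products of linear factors -/

theorem evalAt_eq_of {f p q r : SkewPoly σ δ} (hp : p ≠ 0) (hr : r.degree < p.degree)
    (h : f = q * p + r) : f.evalAt p = r :=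
  (existsUnique_remainder f hp).unique (evalAt_spec f hp) ⟨hr, q, h⟩

theorem degree_add_lt {f g : SkewPoly σ δ} {d : ℕ} (hf : f.degree < d) (hg : g.degree < d) :
    (f + g).degree < d :=
  degree_lt_iff.2 fun m hm => by
    rw [coeff_add, degree_lt_iff.1 hf m hm, degree_lt_iff.1 hg m hm, add_zero]

theorem degree_smul_lt {f : SkewPoly σ δ} {d : ℕ} (c : F) (hf : f.degree < d) :
    (c • f).degree < d :=
  degree_lt_iff.2 fun m hm => by rw [coeff_smul, degree_lt_iff.1 hf m hm, mul_zero]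

theorem evalAt_add (f g : SkewPoly σ δ) {p : SkewPoly σ δ} (hp : p ≠ 0) :
    (f + g).evalAt p = f.evalAt p + g.evalAt p := by
  obtain ⟨d, hd⟩ := exists_degree hp
  obtain ⟨hf, q, hq⟩ := evalAt_spec f hp
  obtain ⟨hg, q', hq'⟩ := evalAt_spec g hp
  refine evalAt_eq_of hp (hd ▸ degree_add_lt (hd ▸ hf) (hd ▸ hg)) (q := q + q') ?_
  rw [add_mul, add_add_add_comm, ← hq, ← hq']

theorem evalAt_smul (c : F) (f : SkewPoly σ δ) {p : SkewPoly σ δ} (hp : p ≠ 0) :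
    (c • f).evalAt p = c • f.evalAt p := by
  obtain ⟨d, hd⟩ := exists_degree hp
  obtain ⟨hf, q, hq⟩ := evalAt_spec f hp
  refine evalAt_eq_of hp (hd ▸ degree_smul_lt c (hd ▸ hf)) (q := C c * q) ?_
  rw [mul_assoc, C_mul, ← smul_add, ← hq]

theorem coeff_X_sub_C_zero (c : F) : (X - C c : SkewPoly σ δ).coeff 0 = -c := by
  simp [X, C, coeff_monomial]

theorem coeff_X_sub_C_one (c : F) : (X - C c : SkewPoly σ δ).coeff 1 = 1 := by
  simp [X, C, coeff_monomial]

theorem degree_X_sub_C (c : F) : (X - C c : SkewPoly σ δ).degree = (1 : ℕ) := by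
  refine degree_eq_iff.2 ⟨by rw [coeff_X_sub_C_one]; exact one_ne_zero, fun m hm => ?_⟩
  rw [X, C, coeff_sub, coeff_monomial, coeff_monomial, if_neg (by omega), if_neg (by omega),
    sub_zero]

theorem X_sub_C_ne_zero (c : F) : (X - C c : SkewPoly σ δ) ≠ 0 := fun h => by
  have := coeff_X_sub_C_one (σ := σ) (δ := δ) c
  rw [h] at this
  exact zero_ne_one this

theorem X_sub_C_injective : Function.Injective fun c : F => (X - C c : SkewPoly σ δ) :=
  fun a b h => neg_injective <| by
    rw [← coeff_X_sub_C_zero (σ := σ) (δ := δ), ← coeff_X_sub_C_zero (σ := σ) (δ := δ)]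
    exact congrArg (coeff · 0) h

/-- Division by `x - c`: the remainder is a constant. -/
theorem exists_eq_mul_X_sub_C_add (f : SkewPoly σ δ) (c : F) :
    ∃ (q : SkewPoly σ δ) (d : F), f = q * (X - C c) + C d := by
  obtain ⟨hr, q, hq⟩ := evalAt_spec f (X_sub_C_ne_zero c)
  rw [degree_X_sub_C] at hr
  refine ⟨q, (f.evalAt (X - C c)).coeff 0, ?_⟩
  conv_lhs => rw [hq]
  congr 1
  ext k
  rcases k with _ | k
  · simp [C, coeff_monomial]
  · rw [degree_lt_iff.1 hr _ (by omega), C, coeff_monomial, if_neg (by omega)]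

theorem linProd_succ {r : ℕ} (a : Fin (r + 1) → F) :
    linProd σ δ a = (X - C (a (Fin.last r))) * linProd σ δ (fun k : Fin r => a k.castSucc) := by
  rw [linProd, List.ofFn_succ', List.concat_eq_append]
  simp [linProd, -List.map_reverse, -List.map_ofFn]

theorem linProd_zero (a : Fin 0 → F) : linProd σ δ a = 1 := by simp [linProd]

theorem linProd_one (a : Fin 1 → F) : linProd σ δ a = X - C (a 0) := by
  simp [linProd]

theorem degree_one : (1 : SkewPoly σ δ).degree = (0 : ℕ) :=
  degree_eq_iff.2 ⟨by simp [one_def, coeff_monomial], fun m hm => by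
    rw [one_def, coeff_monomial, if_neg hm.ne]⟩

theorem degree_linProd {r : ℕ} (a : Fin r → F) : (linProd σ δ a).degree = r := by
  induction r with
  | zero => rw [linProd_zero]; exact degree_one
  | succ r ih =>
    rw [linProd_succ, degree_mul_of_degree_eq (degree_X_sub_C _) (ih _), Nat.add_comm]

theorem coeff_linProd {r : ℕ} (a : Fin r → F) : (linProd σ δ a).coeff r = 1 := by
  induction r with
  | zero => simp [linProd_zero, one_def, coeff_monomial]
  | succ r ih =>
    rw [linProd_succ, sub_mul, X_mul, C_mul, coeff_sub, coeff_smul, coeff_mulX_succ, ih,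
      (degree_eq_iff.1 (degree_linProd _)).2 _ (Nat.lt_succ_self r)]
    simp

theorem ne_zero_of_degree_eq {f : SkewPoly σ δ} {d : ℕ} (h : f.degree = d) : f ≠ 0 := by
  rintro rfl
  exact (degree_eq_iff.1 h).1 rfl

theorem linProd_ne_zero {r : ℕ} (a : Fin r → F) : linProd σ δ a ≠ 0 :=
  ne_zero_of_degree_eq (degree_linProd a)

/-- Earlier entries stand further to the right in the product, so prefixes give right divisors. -/
theorem exists_linProd_eq_mul {r m : ℕ} (a : Fin r → F) (h : m ≤ r) :
    ∃ q, linProd σ δ a = q * linProd σ δ (fun k : Fin m => a (Fin.castLE h k)) := by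
  induction r with
  | zero =>
    obtain rfl : m = 0 := by omega
    exact ⟨1, (one_mul _).symm⟩
  | succ r ih =>
    rcases h.eq_or_lt with rfl | hlt
    · exact ⟨1, (one_mul _).symm⟩
    · obtain ⟨q, hq⟩ := ih (fun k => a k.castSucc) (Nat.lt_succ_iff.1 hlt)
      refine ⟨(X - C (a (Fin.last r))) * q, ?_⟩
      rw [linProd_succ, hq, mul_assoc]
      rfl

/-! ### Hasse derivatives as linear functionals -/

theorem hasseDeriv_add {j : ℕ} (a : Fin (j + 1) → F) (f g : SkewPoly σ δ) :
    hasseDeriv a (f + g) = hasseDeriv a f + hasseDeriv a g := by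
  rw [hasseDeriv, evalAt_add _ _ (linProd_ne_zero a)]; rfl

theorem hasseDeriv_smul {j : ℕ} (a : Fin (j + 1) → F) (c : F) (f : SkewPoly σ δ) :
    hasseDeriv a (c • f) = c * hasseDeriv a f := by
  rw [hasseDeriv, evalAt_smul _ _ (linProd_ne_zero a)]; rfl

theorem hasseDeriv_mul_linProd {j : ℕ} (a : Fin (j + 1) → F) (q : SkewPoly σ δ) :
    hasseDeriv a (q * linProd σ δ a) = 0 := by
  rw [hasseDeriv, evalAt_eq_zero_iff.2 ⟨q, rfl⟩, coeff_zero]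

/-- Once `f` is a left multiple of the product over a prefix, the next Hasse derivative is the
constant `d` left over when the cofactor is divided by the next linear factor; its vanishing extends
the divisibility by one factor. -/
theorem forall_hasseDeriv_eq_zero_iff {r : ℕ} (s : Fin r → F) (f : SkewPoly σ δ) :
    (∀ j, hasseDeriv (initSeg s j) f = 0) ↔ ∃ q, f = q * linProd σ δ s := by
  constructor
  · intro h
    induction r with
    | zero => exact ⟨f, by rw [linProd_zero, mul_one]⟩
    | succ r ih =>
      obtain ⟨q, rfl⟩ := ih (fun k => s k.castSucc) fun j => h j.castSucc
      obtain ⟨q', d, rfl⟩ := exists_eq_mul_X_sub_C_add q (s (Fin.last r))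
      have hsum : (q' * (X - C (s (Fin.last r))) + C d) * linProd σ δ (fun k => s k.castSucc)
          = q' * linProd σ δ s + d • linProd σ δ (fun k => s k.castSucc) := by
        rw [add_mul, mul_assoc, ← linProd_succ, C_mul]
      have hl : (q' * linProd σ δ s + d • linProd σ δ (fun k => s k.castSucc)).evalAt
          (linProd σ δ s) = d • linProd σ δ (fun k => s k.castSucc) := by
        refine evalAt_eq_of (linProd_ne_zero s) ?_ rfl
        rw [degree_linProd]
        refine degree_smul_lt d ?_
        rw [degree_linProd]
        exact WithBot.coe_lt_coe.2 (Nat.lt_succ_self r)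
      have hd : ((q' * linProd σ δ s + d • linProd σ δ (fun k => s k.castSucc)).evalAt
          (linProd σ δ s)).coeff r = 0 := by
        rw [← hsum]
        exact h (Fin.last r)
      rw [hl, coeff_smul, coeff_linProd, mul_one] at hd
      exact ⟨q', by rw [hsum, hd, zero_smul, add_zero]⟩
  · rintro ⟨q, rfl⟩ j
    obtain ⟨q', hq'⟩ := exists_linProd_eq_mul (σ := σ) (δ := δ) s (m := j + 1) j.isLt
    rw [hq', ← mul_assoc]
    exact hasseDeriv_mul_linProd _ _

/-- The Hasse derivatives at the initial segments of the sequences `s i`, as a linear map. -/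
noncomputable def hasseMap (σ : F →+* F) (δ : SkewDerivation σ) {ι : Type*} {r : ι → ℕ}
    (s : ∀ i, Fin (r i) → F) : SkewPoly σ δ →ₗ[F] ((Σ i, Fin (r i)) → F) where
  toFun f ij := hasseDeriv (initSeg (s ij.1) ij.2) f
  map_add' f g := funext fun _ => hasseDeriv_add _ f g
  map_smul' c f := funext fun _ => hasseDeriv_smul _ c f

theorem hasseMap_apply {ι : Type*} {r : ι → ℕ} (s : ∀ i, Fin (r i) → F) (f : SkewPoly σ δ)
    (ij : Σ i, Fin (r i)) :
    hasseMap σ δ s f ij = hasseDeriv (initSeg (s ij.1) ij.2) f := rfl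

theorem hasseMap_eq_zero_iff {ι : Type*} {r : ι → ℕ} (s : ∀ i, Fin (r i) → F)
    (f : SkewPoly σ δ) :
    hasseMap σ δ s f = 0 ↔ ∀ i, ∃ q, f = q * linProd σ δ (s i) := by
  simp only [← forall_hasseDeriv_eq_zero_iff, funext_iff, Sigma.forall]
  rfl

theorem hasseMap_mul_eq_zero {ι : Type*} {r : ι → ℕ} (s : ∀ i, Fin (r i) → F)
    (g f : SkewPoly σ δ) (hf : hasseMap σ δ s f = 0) : hasseMap σ δ s (g * f) = 0 := by
  rw [hasseMap_eq_zero_iff] at hf ⊢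
  intro i
  obtain ⟨q, hq⟩ := hf i
  exact ⟨g * q, by rw [mul_assoc, ← hq]⟩

/-- A single sequence imposes independent conditions whether or not it is a multiplicity sequence: a
left multiple of `linProd σ δ s` of degree below `r` is zero. -/
theorem exists_forall_hasseDeriv_eq {r : ℕ} (s b : Fin r → F) :
    ∃ f : SkewPoly σ δ, ∀ j, hasseDeriv (initSeg s j) f = b j := by
  have hinj : Function.Injective
      (hasseMap σ δ (fun _ : Unit => s) ∘ₗ ofCoeffs σ δ r) := by
    refine (injective_iff_map_eq_zero _).2 fun v hv => ?_
    obtain ⟨q, hq⟩ := (hasseMap_eq_zero_iff (fun _ : Unit => s) (ofCoeffs σ δ r v)).1 hv ()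
    have hlt := degree_ofCoeffs_lt (σ := σ) (δ := δ) v
    rw [← degree_linProd (σ := σ) (δ := δ) s] at hlt
    have h1 := evalAt_eq_of (linProd_ne_zero s) hlt (q := 0) (by rw [zero_mul, zero_add])
    rw [evalAt_eq_zero_iff.2 ⟨q, hq⟩] at h1
    exact ofCoeffs_injective r (h1.symm.trans (map_zero _).symm)
  obtain ⟨v, hv⟩ := (injective_comp_ofCoeffs_iff _ (by simp)).1 hinj fun ij => b ij.2
  exact ⟨_, fun j => congrFun hv ⟨(), j⟩⟩

/-! ### Multiplicity sequences -/

/-- A zero of a right divisor is a zero of the whole product, and the rightmost factor makes the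
first entry a zero. -/
theorem IsMultiplicitySeq.initSeg {r : ℕ} {s : Fin r → F} (h : IsMultiplicitySeq σ δ s)
    (j : Fin r) : IsMultiplicitySeq σ δ (initSeg s j) := by
  obtain ⟨hr, h⟩ := h
  obtain ⟨q, hq⟩ := exists_linProd_eq_mul (σ := σ) (δ := δ) s (m := j + 1) j.isLt
  obtain ⟨q', hq'⟩ := exists_linProd_eq_mul (σ := σ) (δ := δ) (SkewPoly.initSeg s j) (m := 1)
    (Nat.succ_le_succ (Nat.zero_le j))
  refine ⟨Nat.succ_pos _, Set.Subset.antisymm (fun c hc => ?_) ?_⟩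
  · refine h.subset ?_
    obtain ⟨p, hp⟩ := evalAt_eq_zero_iff.1 hc
    refine evalAt_eq_zero_iff.2 ⟨q * p, ?_⟩
    rw [mul_assoc, ← hp]
    exact hq
  · rintro _ rfl
    exact evalAt_eq_zero_iff.2 ⟨q', by rw [hq', linProd_one]; rfl⟩

theorem isMultiplicitySeq_of_forall_initSeg {r : ℕ} (hr : 0 < r) {s : Fin r → F}
    (h : ∀ j, IsMultiplicitySeq σ δ (initSeg s j)) : IsMultiplicitySeq σ δ s := by
  obtain ⟨r, rfl⟩ : ∃ r', r = r' + 1 := ⟨r - 1, by omega⟩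
  exact h (Fin.last r)

/-- In a simple module, a product of linear factors that kills a generator has a zero `c` such
that `x - c` kills the generator. -/
theorem exists_X_sub_C_smul_eq_zero {M : Type*} [AddCommGroup M] [Module (SkewPoly σ δ) M]
    [IsSimpleModule (SkewPoly σ δ) M] {v : M} (hv : v ≠ 0) {r : ℕ} (s : Fin r → F)
    (h : linProd σ δ s • v = 0) : ∃ c, (X - C c : SkewPoly σ δ) • v = 0 := by
  induction r with
  | zero => rw [linProd_zero, one_smul] at h; exact absurd h hv
  | succ r ih =>
    by_cases hw : linProd σ δ (fun k => s k.castSucc) • v = 0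
    · exact ih _ hw
    · obtain ⟨w, hwdef⟩ : ∃ w, w = linProd σ δ (fun k => s k.castSucc) • v := ⟨_, rfl⟩
      rw [← hwdef] at hw
      rw [linProd_succ, mul_smul, ← hwdef] at h
      -- The last linear factor kills `w`, and `w` generates `M` by simplicity, so only constant
      -- remainders act: `M = F w`.
      have hgen : ∀ u : M, ∃ d : F, u = (C d : SkewPoly σ δ) • w := fun u => by
        obtain ⟨f, rfl⟩ := IsSimpleModule.toSpanSingleton_surjective (SkewPoly σ δ) hw u
        obtain ⟨q, d, rfl⟩ := exists_eq_mul_X_sub_C_add f (s (Fin.last r))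
        refine ⟨d, ?_⟩
        rw [LinearMap.toSpanSingleton_apply, add_smul, mul_smul, h, smul_zero, zero_add]
      obtain ⟨d, hd⟩ := hgen v
      obtain ⟨e, he⟩ := hgen ((X : SkewPoly σ δ) • v)
      have hd0 : d ≠ 0 := by
        rintro rfl
        exact hv (by rw [hd, C, map_zero, zero_smul])
      have hCC : ∀ a b : F, (C a * C b : SkewPoly σ δ) = C (a * b) := fun a b => by
        rw [C_mul, C, C, smul_monomial]
      -- From `v = d w` and `x v = e w` follows `x v = (e d⁻¹) v`.
      refine ⟨e * d⁻¹, ?_⟩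
      have hv' : (C (e * d⁻¹) : SkewPoly σ δ) • v = (C e : SkewPoly σ δ) • w := by
        rw [hd, ← mul_smul, hCC, inv_mul_cancel_right₀ hd0]
      rw [sub_smul, he, hv', sub_self]

/-- Some `x - c` kills `v`, so the remainder of the product at `c` is a constant killing `v ≠ 0`,
hence zero. Thus `c` is a zero of the product, and it must be the first entry. -/
theorem IsMultiplicitySeq.X_sub_C_smul_eq_zero {M : Type*} [AddCommGroup M]
    [Module (SkewPoly σ δ) M] [IsSimpleModule (SkewPoly σ δ) M] {r : ℕ} (hr : 0 < r)
    {s : Fin r → F} (hs : IsMultiplicitySeq σ δ s) {v : M} (h : linProd σ δ s • v = 0) :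
    (X - C (s ⟨0, hr⟩) : SkewPoly σ δ) • v = 0 := by
  rcases eq_or_ne v 0 with rfl | hv
  · exact smul_zero _
  obtain ⟨c, hc⟩ := exists_X_sub_C_smul_eq_zero hv s h
  obtain ⟨q, d, hd⟩ := exists_eq_mul_X_sub_C_add (linProd σ δ s) c
  have hd0 : d = 0 := by
    by_contra hne
    rw [hd, add_smul, mul_smul, hc, smul_zero, zero_add] at h
    refine hv ?_
    have h1 : (C d⁻¹ * C d : SkewPoly σ δ) = 1 := by
      rw [C_mul, C, smul_monomial, inv_mul_cancel₀ hne, one_def]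
    rw [← one_smul (SkewPoly σ δ) v, ← h1, mul_smul, h, smul_zero]
  obtain ⟨_, hs⟩ := hs
  have hmem : c ∈ ({s ⟨0, hr⟩} : Set F) := hs.subset <| evalAt_eq_zero_iff.2 ⟨q, by
    rw [hd, hd0, show (C (0 : F) : SkewPoly σ δ) = 0 from map_zero _, add_zero]⟩
  rw [← Set.mem_singleton_iff.1 hmem]
  exact hc

/-! ### Interpolation at points and along multiplicity sequences -/

/-- The points `a i`, seen as sequences of length `1`. -/
def pointSeq {ι : Type*} (a : ι → F) (i : ι) : Fin 1 → F := fun _ => a i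

theorem hasseMap_pointSeq_eq_zero_iff {ι : Type*} (a : ι → F) (f : SkewPoly σ δ) :
    hasseMap σ δ (pointSeq a) f = 0 ↔
      ∀ i, ∃ q : SkewPoly σ δ, f = q * (X - C (a i)) := by
  simp only [hasseMap_eq_zero_iff, linProd_one, pointSeq]

theorem mem_vanishing_range_iff {ι : Type*} (a : ι → F) (f : SkewPoly σ δ) :
    f ∈ vanishing ((fun c => (X - C c : SkewPoly σ δ)) '' Set.range a) ↔
      hasseMap σ δ (pointSeq a) f = 0 := by
  simp [vanishing, hasseMap_pointSeq_eq_zero_iff, evalAt_eq_zero_iff]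

theorem finsum_degree_X_sub_C {n : ℕ} {a : Fin n → F} (ha : Function.Injective a) :
    (∑ᶠ p ∈ (fun c => (X - C c : SkewPoly σ δ)) '' Set.range a, p.degree) = (n : WithBot ℕ) := by
  rw [← Set.range_comp, finsum_mem_range (X_sub_C_injective.comp ha), finsum_eq_sum_of_fintype]
  simp [degree_X_sub_C]

/-- The minimal skew polynomial always has degree at most `n`; it has degree `n` exactly when no
non-zero skew polynomial of degree below `n` vanishes at all the points. -/
theorem pIndependentPoints_iff_surjective {n : ℕ} {a : Fin n → F} (ha : Function.Injective a) :
    PIndependentPoints σ δ (Set.range a) ↔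
      Function.Surjective (hasseMap σ δ (pointSeq a)) := by
  have hcard : n = Fintype.card (Σ _ : Fin n, Fin 1) := by simp
  rw [← surjective_comp_ofCoeffs_iff _ (hasseMap_mul_eq_zero _) hcard,
    ← injective_comp_ofCoeffs_iff _ hcard]
  obtain ⟨p, hp0, hpd, hp⟩ := exists_ne_zero_degree_le (hasseMap σ δ (pointSeq a))
  rw [← hcard] at hpd
  rw [← mem_vanishing_range_iff] at hp
  have halg : IsAlgebraicSet ((fun c => (X - C c : SkewPoly σ δ)) '' Set.range a) := fun h =>
    hp0 (h.subset hp)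
  obtain ⟨hm, hmonic, hmin⟩ : IsMinimalFor _
      (minSkewPoly ((fun c => (X - C c : SkewPoly σ δ)) '' Set.range a)) := by
    rw [minSkewPoly, dif_pos halg]
    exact (existsUnique_isMinimalFor halg).choose_spec.1
  rw [PIndependentPoints, PIndependent, finsum_degree_X_sub_C ha]
  constructor
  · rintro ⟨-, -, hd⟩
    refine (injective_iff_map_eq_zero _).2 fun v hv => ?_
    by_contra hv0
    have := hmin (ofCoeffs σ δ n v) ((mem_vanishing_range_iff _ _).2 hv) fun h0 =>
      hv0 (ofCoeffs_injective n (h0.trans (map_zero _).symm))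
    rw [hd] at this
    exact absurd (degree_ofCoeffs_lt v) (not_lt.2 this)
  · intro hinj
    refine ⟨(Set.finite_range a).image _, halg, le_antisymm ((hmin p hp hp0).trans hpd) ?_⟩
    by_contra hlt
    obtain ⟨v, hv⟩ := exists_ofCoeffs_eq (not_le.1 hlt)
    have hv0 : v = 0 := hinj <| by
      rw [map_zero, LinearMap.comp_apply, hv]
      exact (mem_vanishing_range_iff _ _).1 hm
    obtain ⟨d, hd, -⟩ := hmonic
    refine ne_zero_of_degree_eq hd ?_
    rw [← hv, hv0, map_zero]

/-- If the points `a i` can be interpolated independently, then so can arbitrary residues modulo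
the products `P_{s i}`, for multiplicity sequences `s i` starting at `a i`. -/
theorem exists_forall_eq_mul_linProd_add {ι : Type*} [Fintype ι] {r : ι → ℕ} (hr : ∀ i, 0 < r i)
    {s : ∀ i, Fin (r i) → F} (hs : ∀ i, IsMultiplicitySeq σ δ (s i)) {a : ι → F}
    (ha : ∀ i, s i ⟨0, hr i⟩ = a i) (h : Function.Surjective (hasseMap σ δ (pointSeq a)))
    (g : ι → SkewPoly σ δ) : ∃ f, ∀ i, ∃ q, f = q * linProd σ δ (s i) + g i := by
  classical
  let I : ι → Submodule (SkewPoly σ δ) (SkewPoly σ δ) := fun i =>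
    Submodule.span (SkewPoly σ δ) {linProd σ δ (s i)}
  let φ : SkewPoly σ δ →ₗ[SkewPoly σ δ] (∀ i, SkewPoly σ δ ⧸ I i) :=
    LinearMap.pi fun i => (I i).mkQ
  suffices hφ : LinearMap.range φ = ⊤ by
    obtain ⟨f, hf⟩ := LinearMap.range_eq_top.1 hφ fun i => (I i).mkQ (g i)
    refine ⟨f, fun i => ?_⟩
    obtain ⟨q, hq⟩ := Submodule.mem_span_singleton.1
      ((Submodule.Quotient.eq (I i)).1 (congrFun hf i))
    exact ⟨q, by rw [← smul_eq_mul, hq, sub_add_cancel]⟩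
  -- The product of cyclic modules is finitely generated, so a proper submodule lies in a maximal
  -- one.
  rcases eq_top_or_exists_le_coatom (LinearMap.range φ) with h' | ⟨K, hK, hle⟩
  · exact h'
  exfalso
  let e : ι → (∀ i, SkewPoly σ δ ⧸ I i) := fun i => Pi.single i ((I i).mkQ 1)
  have : IsSimpleModule (SkewPoly σ δ) ((∀ i, SkewPoly σ δ ⧸ I i) ⧸ K) :=
    isSimpleModule_iff_isCoatom.2 hK
  have hse : ∀ f i, f • e i = Pi.single i ((I i).mkQ f) := fun f i => by
    rw [← Pi.single_smul, ← map_smul, smul_eq_mul, mul_one]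
  have hφe : ∀ f, φ f = ∑ i, f • e i := fun f => by
    simp only [hse]
    exact (Finset.univ_sum_single (φ f)).symm
  have hlin : ∀ i, linProd σ δ (s i) • e i = 0 := fun i => by
    rw [hse, Submodule.mkQ_apply,
      (Submodule.Quotient.mk_eq_zero (I i)).2 (Submodule.mem_span_singleton_self _)]
    exact Pi.single_zero i
  -- Here the multiplicity condition is used, in the simple quotient by `K`.
  have hX : ∀ i, (X - C (a i) : SkewPoly σ δ) • e i ∈ K := fun i => by
    rw [← Submodule.Quotient.mk_eq_zero K, Submodule.Quotient.mk_smul, ← ha i]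
    refine (hs i).X_sub_C_smul_eq_zero (hr i) ?_
    rw [← Submodule.Quotient.mk_smul, hlin, Submodule.Quotient.mk_zero]
  have hmem : ∀ i, e i ∈ K := fun i => by
    -- Modulo `K`, this `f` acts as `1` on `e i` and as `0` on every other `e j`, while `φ f = ∑ j,
    -- f • e j` lies in `K`; hence `e i ∈ K`.
    obtain ⟨f, hf⟩ := h fun ij => if ij.1 = i then hasseMap σ δ (pointSeq a) 1 ij else 0
    have hf0 : ∀ j, j ≠ i → f • e j ∈ K := fun j hj => by
      -- The one-point family indexed by `Unit` isolates divisibility at the single point `a j`.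
      obtain ⟨q, hq⟩ := (hasseMap_pointSeq_eq_zero_iff (fun _ : Unit => a j) f).1
        (funext fun ij => by
          have := congrFun hf ⟨j, ij.2⟩
          rwa [if_neg hj] at this) ()
      rw [hq, mul_smul]
      exact K.smul_mem _ (hX j)
    have hf1 : (f - 1) • e i ∈ K := by
      obtain ⟨q, hq⟩ := (hasseMap_pointSeq_eq_zero_iff (fun _ : Unit => a i) (f - 1)).1
        (funext fun ij => by
          have := congrFun hf ⟨i, ij.2⟩
          rw [if_pos rfl] at this
          rw [map_sub, Pi.sub_apply]
          exact sub_eq_zero.2 this) ()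
      rw [hq, mul_smul]
      exact K.smul_mem _ (hX i)
    have hfi : f • e i ∈ K := by
      have hsum : ∑ j, f • e j ∈ K := by
        rw [← hφe]
        exact hle ⟨f, rfl⟩
      rw [← Finset.add_sum_erase _ _ (Finset.mem_univ i)] at hsum
      exact (K.add_mem_iff_left (K.sum_mem fun j hj => hf0 j (Finset.ne_of_mem_erase hj))).1 hsum
    have := K.sub_mem hfi hf1
    rwa [← sub_smul, sub_sub_cancel, one_smul] at this
  refine hK.1 ((Submodule.eq_top_iff').2 fun u => ?_)
  rw [← Finset.univ_sum_single u]
  refine K.sum_mem fun i _ => ?_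
  obtain ⟨f, hf⟩ := (I i).mkQ_surjective (u i)
  rw [← hf, ← hse]
  exact K.smul_mem f (hmem i)

theorem hasseDeriv_congr {r : ℕ} {s : Fin r → F} {f g q : SkewPoly σ δ}
    (h : f = q * linProd σ δ s + g) (j : Fin r) :
    hasseDeriv (initSeg s j) f = hasseDeriv (initSeg s j) g := by
  rw [h, hasseDeriv_add, (forall_hasseDeriv_eq_zero_iff s _).2 ⟨q, rfl⟩ j, zero_add]

theorem hasseMap_surjective_of_pointSeq {ι : Type*} [Fintype ι] {r : ι → ℕ} (hr : ∀ i, 0 < r i)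
    {s : ∀ i, Fin (r i) → F} (hs : ∀ i, IsMultiplicitySeq σ δ (s i)) {a : ι → F}
    (ha : ∀ i, s i ⟨0, hr i⟩ = a i) (h : Function.Surjective (hasseMap σ δ (pointSeq a))) :
    Function.Surjective (hasseMap σ δ s) := by
  intro b
  choose g hg using fun i => exists_forall_hasseDeriv_eq (σ := σ) (δ := δ) (s i) fun j => b ⟨i, j⟩
  obtain ⟨f, hf⟩ := exists_forall_eq_mul_linProd_add hr hs ha h g
  refine ⟨f, funext fun ⟨i, j⟩ => ?_⟩
  obtain ⟨q, hq⟩ := hf i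
  exact (hasseDeriv_congr hq j).trans (hg i j)

theorem hasseMap_pointSeq_surjective {ι : Type*} {r : ι → ℕ} (hr : ∀ i, 0 < r i)
    {s : ∀ i, Fin (r i) → F} {a : ι → F} (ha : ∀ i, s i ⟨0, hr i⟩ = a i)
    (h : Function.Surjective (hasseMap σ δ s)) :
    Function.Surjective (hasseMap σ δ (pointSeq a)) := by
  intro b
  obtain ⟨f, hf⟩ := h fun ij => b ⟨ij.1, 0⟩
  refine ⟨f, funext fun ⟨i, j⟩ => ?_⟩
  obtain rfl : j = 0 := Subsingleton.elim _ _
  rw [← congrFun hf ⟨i, ⟨0, hr i⟩⟩, hasseMap_apply, hasseMap_apply]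
  refine congrArg (fun t : Fin 1 → F => hasseDeriv t f) (funext fun (k : Fin 1) => ?_)
  obtain rfl : k = 0 := Subsingleton.elim _ _
  exact (ha i).symm

/-! ### The confluent Vandermonde matrix -/

/-- The matrix represents `hasseMap` on coefficient row vectors; they act from the left because
Hasse derivatives are left-linear. -/
theorem vecMul_confluentVandermonde {n : ℕ} {r : Fin n → ℕ} {N : ℕ} (s : ∀ i, Fin (r i) → F)
    (v : Fin N → F) (c : Fin (∑ i, r i)) :
    Matrix.vecMul v (confluentVandermonde σ δ N s) c =
      hasseMap σ δ s (ofCoeffs σ δ N v) (finSigmaFinEquiv.symm c) := by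
  have h : ofCoeffs σ δ N v = ∑ k : Fin N, v k • (X ^ (k : ℕ) : SkewPoly σ δ) := by
    simp only [ofCoeffs_apply, X_pow, smul_monomial, mul_one]
  rw [h, map_sum, Finset.sum_apply]
  simp only [map_smul]
  rfl

theorem isUnit_confluentVandermonde_iff {n : ℕ} {r : Fin n → ℕ} (s : ∀ i, Fin (r i) → F) :
    IsUnit (confluentVandermonde σ δ (∑ i, r i) s) ↔
      Function.Surjective (hasseMap σ δ s ∘ₗ ofCoeffs σ δ (∑ i, r i)) := by
  constructor
  · rintro h
    obtain ⟨W, hW⟩ := h.exists_left_inv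
    intro b
    refine ⟨Matrix.vecMul (fun c => b (finSigmaFinEquiv.symm c)) W, funext fun ij => ?_⟩
    have := vecMul_confluentVandermonde (σ := σ) (δ := δ) s
      (Matrix.vecMul (fun c => b (finSigmaFinEquiv.symm c)) W) (finSigmaFinEquiv ij)
    rw [Matrix.vecMul_vecMul, hW, Matrix.vecMul_one, Equiv.symm_apply_apply] at this
    exact this.symm
  · intro h
    choose W hW using fun k : Fin (∑ i, r i) => h fun ij =>
      (1 : Matrix (Fin (∑ i, r i)) (Fin (∑ i, r i)) F) k (finSigmaFinEquiv ij)
    -- The rows of `W` are preimages of the unit vectors, giving a left inverse; for square matrices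
    -- over a division ring a one-sided inverse suffices.
    refine IsUnit.of_mul_eq_one_right (Matrix.of W) (Matrix.ext fun k c => ?_)
    refine (vecMul_confluentVandermonde (σ := σ) (δ := δ) s (W k) c).trans ?_
    refine (congrFun (hW k) _).trans ?_
    rw [Equiv.apply_symm_apply]

theorem existsUnique_interpolation_iff {n : ℕ} {r : Fin n → ℕ} (s : ∀ i, Fin (r i) → F) :
    (∀ b : ∀ i, Fin (r i) → F,
      ∃! f : SkewPoly σ δ, f.degree < ((∑ i, r i : ℕ) : WithBot ℕ) ∧
        ∀ i j, hasseDeriv (initSeg (s i) j) f = b i j) ↔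
      Function.Surjective (hasseMap σ δ s) := by
  have hcard : ∑ i, r i = Fintype.card (Σ i, Fin (r i)) := by simp
  constructor
  · intro h b
    obtain ⟨f, ⟨-, hf⟩, -⟩ := h fun i j => b ⟨i, j⟩
    exact ⟨f, funext fun ij => hf ij.1 ij.2⟩
  · intro h b
    have hsurj := (surjective_comp_ofCoeffs_iff _ (hasseMap_mul_eq_zero s) hcard).2 h
    obtain ⟨v, hv⟩ := hsurj fun ij => b ij.1 ij.2
    refine ⟨ofCoeffs σ δ _ v, ⟨degree_ofCoeffs_lt v, fun i j => congrFun hv ⟨i, j⟩⟩, ?_⟩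
    rintro g ⟨hgd, hg⟩
    obtain ⟨w, rfl⟩ := exists_ofCoeffs_eq hgd
    refine congrArg _ ((injective_comp_ofCoeffs_iff _ hcard).2 hsurj (Eq.trans ?_ hv.symm))
    exact funext fun ij => hg ij.1 ij.2

end SkewPoly
end Ore

/-! ### The equivalence -/

theorem mainTheorem3 {F : Type*} [DivisionRing F] (σ : F →+* F) (δ : Ore.SkewDerivation σ)
    {n : ℕ} (hn : 0 < n) (a : Fin n → F) (ha : Function.Injective a)
    (r : Fin n → ℕ) (hr : ∀ i, 0 < r i)
    (hex : ∀ i, ∃ s : Fin (r i) → F, Ore.SkewPoly.IsMultiplicitySeq σ δ s ∧ s ⟨0, hr i⟩ = a i) :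
    List.TFAE
      [Ore.SkewPoly.PIndependentPoints σ δ (Set.range a),
       ∀ (b : ∀ i, Fin (r i) → F) (s : ∀ i, Fin (r i) → F),
          (∀ i j, Ore.SkewPoly.IsMultiplicitySeq σ δ (Ore.SkewPoly.initSeg (s i) j)) → (∀ i, s i ⟨0, hr i⟩ = a i) →
          ∃! f : Ore.SkewPoly σ δ, f.degree < ((∑ i, r i : ℕ) : WithBot ℕ) ∧
            ∀ i j, Ore.SkewPoly.hasseDeriv (Ore.SkewPoly.initSeg (s i) j) f = b i j,
       ∀ s : ∀ i, Fin (r i) → F,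
          (∀ i, Ore.SkewPoly.IsMultiplicitySeq σ δ (s i)) → (∀ i, s i ⟨0, hr i⟩ = a i) →
          IsUnit (Ore.SkewPoly.confluentVandermonde σ δ (∑ i, r i) s)] := by
  have hcard : ∑ i, r i = Fintype.card (Σ i, Fin (r i)) := by simp
  choose t ht hta using hex
  rw [Ore.SkewPoly.pIndependentPoints_iff_surjective ha]
  tfae_have 1 → 2 := fun h b s hs hsa =>
    (Ore.SkewPoly.existsUnique_interpolation_iff s).2
      (Ore.SkewPoly.hasseMap_surjective_of_pointSeq hr
        (fun i => Ore.SkewPoly.isMultiplicitySeq_of_forall_initSeg (hr i) (hs i)) hsa h) b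
  tfae_have 2 → 3 := fun h s hs hsa => by
    rw [Ore.SkewPoly.isUnit_confluentVandermonde_iff,
      Ore.SkewPoly.surjective_comp_ofCoeffs_iff _ (Ore.SkewPoly.hasseMap_mul_eq_zero s) hcard]
    exact (Ore.SkewPoly.existsUnique_interpolation_iff s).1 fun b =>
      h b s (fun i j => (hs i).initSeg j) hsa
  tfae_have 3 → 1 := fun h => by
    -- The assumed existence of multiplicity sequences enters here; without them statement 3 would
    -- be vacuous.
    have ht' := h t ht hta
    rw [Ore.SkewPoly.isUnit_confluentVandermonde_iff,
      Ore.SkewPoly.surjective_comp_ofCoeffs_iff _ (Ore.SkewPoly.hasseMap_mul_eq_zero t) hcard]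
      at ht'
    exact Ore.SkewPoly.hasseMap_pointSeq_surjective hr hta ht'
  tfae_finish
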